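/- Let $n \ge 1$ and let $P$ be a directed path with vertices $v_1,\dots,v_n$ and edges $(v_i,v_{i+1})$, $1\le i\le n-1$, where each edge is assigned a label from $\{U,D,L,R\}$ (up, down, left, right) and at most three of the four labels are used. Let $S$ be any set of $n$ points in the plane that is in convex position (no point of $S$ lies in the convex hull of the other points of $S$) and in general position (no three points of $S$ are collinear, and no two have the same $x$-coordinate or the same $y$-coordinate). Then $P$ has a planar direction-consistent embedding on $S$. That is, there is an injective map $\mathcal{E}\colon\{v_1,\dots,v_n\}\to S$ such that, when each edge $(v_i,v_{i+1})$ is drawn as the straight-line segment from $\mathcal{E}(v_i)$ to $\mathcal{E}(v_{i+1})$, any two distinct edges meet only in the image of a common end vertex (so no two edges cross), and every edge points in its labeled direction: $\mathcal{E}(v_{i+1})$ lies above, below, to the left of, or to the right of $\mathcal{E}(v_i)$ (strictly larger $y$-, smaller $y$-, smaller $x$-, larger $x$-coordinate) if the label of $(v_i,v_{i+1})$ is $U$, $D$, $L$, or $R$, respectively. -/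

import Mathlib

/-- The four edge labels: up, down, left, right. -/
inductive Direction : Type where
  | U : Direction
  | D : Direction
  | L : Direction
  | R : Direction

/-- A labeled directed path with `m` edges and the `m + 1` vertices `0, 1, …, m`. The `i`-th edge
is directed from vertex `i` to vertex `i + 1`, and its label is the `i`-th entry. -/
abbrev LabeledPath (m : ℕ) : Type := Fin m → Direction

/-- All labels of the path belong to `T`. -/
def LabeledPath.IsTPath {m : ℕ} (P : LabeledPath m) (T : Finset Direction) : Prop :=
  ∀ i : Fin m, P i ∈ T

/-- The path uses at most three of the four labels. -/
def LabeledPath.IsThreeDirectional {m : ℕ} (P : LabeledPath m) : Prop :=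
  ∃ T : Finset Direction, T.card ≤ 3 ∧ P.IsTPath T

/-- The segment directed from `p` to `q` points in the given direction
(first coordinate: `x`, second coordinate: `y`). -/
def PointsIn : Direction → ℝ × ℝ → ℝ × ℝ → Prop
  | Direction.U, p, q => p.2 < q.2
  | Direction.D, p, q => q.2 < p.2
  | Direction.L, p, q => q.1 < p.1
  | Direction.R, p, q => p.1 < q.1

/-- No two points have the same `x`- or the same `y`-coordinate, and no three are collinear. -/
def InGeneralPosition (S : Finset (ℝ × ℝ)) : Prop :=
  (∀ p ∈ S, ∀ q ∈ S, p ≠ q → p.1 ≠ q.1 ∧ p.2 ≠ q.2) ∧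
  (∀ p ∈ S, ∀ q ∈ S, ∀ r ∈ S, p ≠ q → p ≠ r → q ≠ r → ¬ Collinear ℝ {p, q, r})

/-- No point of `S` lies in the convex hull of other points of `S`. -/
def InConvexPosition (S : Finset (ℝ × ℝ)) : Prop :=
  ConvexIndependent ℝ (fun p : S => (p : ℝ × ℝ))

/-- An embedding of a path with `m` edges on `S`: an injective map from its vertices to `S`. -/
def IsEmbeddingOn {m : ℕ} (S : Finset (ℝ × ℝ)) (E : Fin (m + 1) → ℝ × ℝ) : Prop :=
  Function.Injective E ∧ ∀ v, E v ∈ S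

/-- Vertex `v` is one of the two ends of the `i`-th edge. -/
def IsEndOf {m : ℕ} (v : Fin (m + 1)) (i : Fin m) : Prop :=
  v = i.castSucc ∨ v = i.succ

/-- The straight-line drawing of the path given by the vertex placement `E` is planar: two
distinct edges, drawn as closed segments, meet only in the image of a common end vertex. -/
def IsPlanarDrawing {m : ℕ} (E : Fin (m + 1) → ℝ × ℝ) : Prop :=
  ∀ i j : Fin m, i ≠ j →
    ∀ x, x ∈ segment ℝ (E i.castSucc) (E i.succ) → x ∈ segment ℝ (E j.castSucc) (E j.succ) →
      ∃ v : Fin (m + 1), IsEndOf v i ∧ IsEndOf v j ∧ x = E v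

/-- Every edge points in the direction given by its label. -/
def IsDirectionConsistent {m : ℕ} (P : LabeledPath m) (E : Fin (m + 1) → ℝ × ℝ) : Prop :=
  ∀ i : Fin m, PointsIn (P i) (E i.castSucc) (E i.succ)

/-!
Number the points of `S` counterclockwise and extend the numbering periodically to `γ : ℤ → ℝ × ℝ`
(`exists_convexPolygon`). A Hamiltonian path is drawn without crossings as soon as every initial
part of it occupies an interval of consecutive points and has its current vertex at an end of that
interval: then all earlier vertices lie strictly on one side of the next edge
(`ConvexPolygon.exists_vertices`, `isPlanarDrawing_of_orient`). Convexity is used for nothing else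
except that `x` and `y` are unimodal along the boundary, so the problem becomes one about growing
intervals of integers (`Sweep`).

Rotating by quarter turns and reflecting in a horizontal line, one may assume that the label `L`
does not occur and that the lowest point `b` (index `0`) has a smaller `x`-coordinate than the
highest point `t` (index `τ`); see `TiltedPolygon`. Let the left chain go from `t` to `b` through
the leftmost point, and the right chain from `b` to `t` through the rightmost one.

On every interval of the left chain, the points extreme in the directions `U`, `D` and `R` are end
points of the interval. Hence any path can be put on it backwards, each vertex being extreme in the
direction of the edge that enters it (`TiltedPolygon.greedy`). The half-turn of the plane combined
with the reversal of the path preserves all labels and exchanges the two chains, so the last part of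
the path can be treated like the first one on the right chain (`TiltedPolygon.rotate`). What
remains is to connect the two parts. An interval can be enlarged along two chains which are
monotone in all directions that occur among the labels, by always moving to the end which is
smallest for the label that comes next (`Sweep.exists_merge`).

Let `k = n - τ` be the number of points of the left chain without `t`. If the `k`-th edge is
labelled `D`, the maximal run of `D` through it starts at `t` and ends at `b`, and is put on the
points left over by the two greedy parts in decreasing order of `y`
(`TiltedPolygon.traverse_of_down`). Otherwise let `Q` be the set of points not to the right of `b`,
and `Q'` the set of points not to the left of `t`. Outside `Q` and `Q'`, both chains increase in `x`
and in `y` from the side of `b` to the side of `t`, so a word over `{U, R}` can be put there without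
trouble. The point is to cover `Q` in such a way that the edge leaving it can go to every point in
the middle (`TiltedPolygon.front`). If that edge is labelled `R` this is automatic, because `Q` is to
the left of everything else. If it is labelled `U`, its run of `U` is started at `b` and takes up,
in increasing order of `y`, the rest of `Q` together with points of the right chain below the top
point of `Q`. This and its rotated copy fit together unless a single run of `U` covers everything
between `Q` and `Q'`; that run is put on the remaining points in increasing order of `y`
(`TiltedPolygon.traverse_of_up`).
-/

/-! ### Growing intervals -/

/-- `Sweep r x y c`: the first `y - x + 1` vertices of a path can be placed on the indices in
`[x, y]`, the last of them at `c`, so that every initial part occupies an interval. Here `r s i j`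
says that the edge number `s` may go from `i` to `j`. The numbering of the edges starts with `0`, so
that `y - x` is the number of the edge which leaves `c`. -/
inductive Sweep (r : ℤ → ℤ → ℤ → Prop) : ℤ → ℤ → ℤ → Prop
  | single (x : ℤ) : Sweep r x x x
  | left {x y c : ℤ} : Sweep r x y c → r (y - x) c (x - 1) → Sweep r (x - 1) y (x - 1)
  | right {x y c : ℤ} : Sweep r x y c → r (y - x) c (y + 1) → Sweep r x (y + 1) (y + 1)

namespace Sweep

variable {r : ℤ → ℤ → ℤ → Prop}

theorem mem_Icc {x y c : ℤ} (h : Sweep r x y c) : x ≤ c ∧ c ≤ y := by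
  induction h <;> omega

theorem extend_left {x y c x' : ℤ} (h : Sweep r x y c) (hx : x' = x - 1)
    (hr : r (y - x) c x') : Sweep r x' y x' := by
  subst hx; exact h.left hr

theorem extend_right {x y c y' : ℤ} (h : Sweep r x y c) (hy : y' = y + 1)
    (hr : r (y - x) c y') : Sweep r x y' y' := by
  subst hy; exact h.right hr

theorem add_right {x y c : ℤ} (d : ℤ) (h : Sweep (fun s i j => r s (i + d) (j + d)) x y c) :
    Sweep r (x + d) (y + d) (c + d) := by
  induction h with
  | single x => exact .single _
  | left _ hr ih => exact ih.extend_left (by ring) (by rwa [add_sub_add_right_eq_sub])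
  | right _ hr ih => exact ih.extend_right (by ring) (by rwa [add_sub_add_right_eq_sub])

theorem neg {x y c : ℤ} (h : Sweep (fun s i j => r s (-i) (-j)) x y c) :
    Sweep r (-y) (-x) (-c) := by
  induction h with
  | single x => exact .single _
  | @left x y c _ hr ih =>
    exact ih.extend_right (by ring) (by rwa [show -x - -y = y - x by ring])
  | @right x y c _ hr ih =>
    exact ih.extend_left (by ring) (by rwa [show -x - -y = y - x by ring])

/-- On indices modulo `n`, a sweep of `[x, y]` by the first part of a path and a sweep of the
complement by the reversed rest of the path, shifted by `τ`, combine if the edge between the two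
current vertices is allowed. -/
theorem join {n τ : ℤ} (hper : ∀ s i j, r s i (j + n) ↔ r s i j)
    (hper' : ∀ s i j, r s (i + n) j ↔ r s i j)
    {x' y' d : ℤ} (h' : Sweep (fun s i j => r (n - 2 - s) (j + τ) (i + τ)) x' y' d) :
    ∀ {x y c : ℤ}, Sweep r x y c → x' + τ = y + 1 → y' + τ = x - 1 + n →
      r (y - x) c (d + τ) → ∃ x c, Sweep r x (x + n - 1) c := by
  induction h' with
  | single x' =>
    intro x y c h hx hy hr
    refine ⟨x, y + 1, ?_⟩
    rw [show x + n - 1 = y + 1 by omega]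
    exact h.extend_right rfl (by rwa [← hx])
  | @left x' y' c' h' hr' ih =>
    intro x y c h hx hy hr
    refine ih (h.extend_right rfl (by rwa [← hx])) (by omega) hy ?_
    rw [← hx, show x' - 1 + τ - x = n - 2 - (y' - x') by omega]
    exact hr'
  | @right x' y' c' h' hr' ih =>
    intro x y c h hx hy hr
    refine ih (h.extend_left rfl ?_) hx (by omega) ?_
    · rw [← hper, show x - 1 + n = y' + 1 + τ by omega]
      exact hr
    · rw [← hper', show y - (x - 1) = n - 2 - (y' - x') by omega,
        show x - 1 + n = y' + 1 + τ by omega]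
      exact hr'

end Sweep

/-- The edge number `s` of a path with labels `e` may go from `γ i` to `γ j`. -/
def StepRel (e : ℤ → Direction) (γ : ℤ → ℝ × ℝ) (s i j : ℤ) : Prop :=
  PointsIn (e s) (γ i) (γ j)

/-- A sweep of `[x, y]` extends to `[x', y']` along any labels from `T` if both added chains,
traversed outwards, proceed in all directions of `T`, and the first edge can go from the current
vertex to every added point. The next vertex is the end that is smallest for the label of the edge
after the next, so that this last condition is preserved. -/
theorem Sweep.exists_merge {e : ℤ → Direction} {γ : ℤ → ℝ × ℝ} (T : Set Direction) (k : ℕ) :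
    ∀ {x y c x' y' : ℤ}, Sweep (StepRel e γ) x y c → x' ≤ x → y ≤ y' →
      (x - x') + (y' - y) = k →
      (∀ l ∈ T, ∀ i j, x' ≤ j → j < i → i < x → PointsIn l (γ i) (γ j)) →
      (∀ l ∈ T, ∀ i j, y < i → i < j → j ≤ y' → PointsIn l (γ i) (γ j)) →
      (∀ l ∈ T, ∀ i j, x' ≤ i → i < x → y < j → j ≤ y' →
        PointsIn l (γ i) (γ j) ∨ PointsIn l (γ j) (γ i)) →
      (∀ s, y - x ≤ s → s < y' - x' → e s ∈ T) →
      (∀ i, (x' ≤ i ∧ i < x) ∨ (y < i ∧ i ≤ y') → PointsIn (e (y - x)) (γ c) (γ i)) →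
      ∃ c', Sweep (StepRel e γ) x' y' c' ∧
        ((c' = c ∧ x' = x ∧ y' = y) ∨ (x' ≤ c' ∧ c' < x) ∨ (y < c' ∧ c' ≤ y')) := by
  induction k with
  | zero =>
    intro x y c x' y' h hx hy hk _ _ _ _ _
    obtain rfl : x' = x := by omega
    obtain rfl : y' = y := by omega
    exact ⟨c, h, by simp⟩
  | succ k ih =>
    intro x y c x' y' h hx hy hk hl hr hlr he hc
    push_cast at hk
    have goLeft : x' < x → (k ≠ 0 → ∀ i, (x' ≤ i ∧ i < x - 1) ∨ (y < i ∧ i ≤ y') →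
        PointsIn (e (y - x + 1)) (γ (x - 1)) (γ i)) → ∃ c', Sweep (StepRel e γ) x' y' c' ∧
        ((c' = c ∧ x' = x ∧ y' = y) ∨ (x' ≤ c' ∧ c' < x) ∨ (y < c' ∧ c' ≤ y')) := by
      intro hlt hmin
      obtain ⟨c', h1, h2⟩ := ih (x := x - 1) (y := y) (x' := x') (y' := y')
        (h.left (hc _ (by omega))) (by omega) hy (by omega)
        (fun l hl' i j h1 h2 h3 => hl l hl' i j h1 h2 (by omega)) hr
        (fun l hl' i j h1 h2 h3 h4 => hlr l hl' i j h1 (by omega) h3 h4)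
        (fun s h1 h2 => he s (by omega) h2)
        (fun i hi => by
          rw [show y - (x - 1) = y - x + 1 by ring]
          exact hmin (by omega) i hi)
      exact ⟨c', h1, by omega⟩
    have goRight : y < y' → (k ≠ 0 → ∀ i, (x' ≤ i ∧ i < x) ∨ (y + 1 < i ∧ i ≤ y') →
        PointsIn (e (y - x + 1)) (γ (y + 1)) (γ i)) → ∃ c', Sweep (StepRel e γ) x' y' c' ∧
        ((c' = c ∧ x' = x ∧ y' = y) ∨ (x' ≤ c' ∧ c' < x) ∨ (y < c' ∧ c' ≤ y')) := by
      intro hlt hmin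
      obtain ⟨c', h1, h2⟩ := ih (x := x) (y := y + 1) (x' := x') (y' := y')
        (h.right (hc _ (by omega))) hx (by omega) (by omega) hl
        (fun l hl' i j h1 h2 h3 => hr l hl' i j (by omega) h2 h3)
        (fun l hl' i j h1 h2 h3 h4 => hlr l hl' i j h1 h2 (by omega) h4)
        (fun s h1 h2 => he s (by omega) h2)
        (fun i hi => by
          rw [show y + 1 - x = y - x + 1 by ring]
          exact hmin (by omega) i hi)
      exact ⟨c', h1, by omega⟩
    have htr : ∀ l p q u, PointsIn l p q → PointsIn l q u → PointsIn l p u := by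
      intro l p q u h1 h2
      cases l <;> simp only [PointsIn] at * <;> linarith
    by_cases h1 : x' < x
    · by_cases h2 : y < y'
      · have hT : e (y - x + 1) ∈ T := he _ (by omega) (by omega)
        rcases hlr _ hT (x - 1) (y + 1) (by omega) (by omega) (by omega) (by omega) with h3 | h3
        · refine goLeft h1 fun _ i hi => ?_
          rcases hi with hi | hi
          · exact hl _ hT _ _ hi.1 hi.2 (by omega)
          · rcases eq_or_ne i (y + 1) with rfl | hne
            · exact h3
            · exact htr _ _ _ _ h3 (hr _ hT _ _ (by omega) (by omega) hi.2)
        · refine goRight h2 fun _ i hi => ?_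
          rcases hi with hi | hi
          · rcases eq_or_ne i (x - 1) with rfl | hne
            · exact h3
            · exact htr _ _ _ _ h3 (hl _ hT _ _ hi.1 (by omega) (by omega))
          · exact hr _ hT _ _ (by omega) hi.1 hi.2
      · refine goLeft h1 fun hk0 i hi => ?_
        exact hl _ (he _ (by omega) (by omega)) _ _ (by omega) (by omega) (by omega)
    · refine goRight (by omega) fun hk0 i hi => ?_
      exact hr _ (he _ (by omega) (by omega)) _ _ (by omega) (by omega) (by omega)

/-- The start of the maximal run on which `p` holds, within `[a, b]` and ending at `b`. -/
theorem exists_run_start (p : ℤ → Prop) {a b : ℤ} (hab : a ≤ b) (hb : p b) :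
    ∃ k, a ≤ k ∧ k ≤ b ∧ (∀ s, k ≤ s → s ≤ b → p s) ∧ (k = a ∨ ¬ p (k - 1)) := by
  revert hb
  induction b, hab using Int.leInduction with
  | base => exact fun hb => ⟨a, le_rfl, le_rfl, fun s h1 h2 => le_antisymm h1 h2 ▸ hb, .inl rfl⟩
  | succ b hab ih =>
    intro hb
    by_cases h : p b
    · obtain ⟨k, h1, h2, h3, h4⟩ := ih h
      refine ⟨k, h1, by omega, fun s h5 h6 => ?_, h4⟩
      rcases eq_or_ne s (b + 1) with rfl | hne
      · exact hb
      · exact h3 s h5 (by omega)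
    · exact ⟨b + 1, by omega, le_rfl, fun s h1 h2 => le_antisymm h1 h2 ▸ hb, .inr (by simpa)⟩

/-! ### The three-directional word problem on a tilted polygon -/

/-- The properties of a convex polygon with `n` vertices that the construction uses: index `0` is the
lowest vertex, index `τ` the highest one and further to the right. The right chain has the indices
`0, …, τ`, the left chain the indices `τ - n, …, 0`. The `x`-coordinate is strictly quasiconcave on
the right chain and strictly quasiconvex on the left one. -/
structure TiltedPolygon (n τ : ℤ) (γ : ℤ → ℝ × ℝ) : Prop where
  pos : 0 < τ
  lt : τ < n
  periodic : ∀ i, γ (i + n) = γ i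
  ne : ∀ i j, i < j → j < i + n → (γ i).1 ≠ (γ j).1 ∧ (γ i).2 ≠ (γ j).2
  y_right : ∀ i j, 0 ≤ i → i < j → j ≤ τ → (γ i).2 < (γ j).2
  y_left : ∀ i j, τ - n ≤ i → i < j → j ≤ 0 → (γ j).2 < (γ i).2
  x_right : ∀ i j k, 0 ≤ i → i < j → j < k → k ≤ τ → min (γ i).1 (γ k).1 < (γ j).1
  x_left : ∀ i j k, τ - n ≤ i → i < j → j < k → k ≤ 0 → (γ j).1 < max (γ i).1 (γ k).1
  tilt : (γ 0).1 < (γ τ).1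

/-- The vertices not to the right of the lowest one are those with index in `(-q, 0]`; only the left
chain need be considered, as all other vertices of the right chain are further to the right. -/
def IsShadow (n τ : ℤ) (γ : ℤ → ℝ × ℝ) (q : ℤ) : Prop :=
  1 ≤ q ∧ q ≤ n - τ ∧ (∀ i, -q < i → i ≤ 0 → (γ i).1 ≤ (γ 0).1) ∧
    ∀ i, τ - n ≤ i → i ≤ -q → (γ 0).1 < (γ i).1

theorem pointsIn_neg (l : Direction) (p q : ℝ × ℝ) : PointsIn l (-p) (-q) ↔ PointsIn l q p := by
  cases l <;> simp [PointsIn]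

namespace TiltedPolygon

variable {n τ : ℤ} {γ : ℤ → ℝ × ℝ} {e : ℤ → Direction}

/-- The half-turn of the plane exchanges the two chains. -/
theorem rotate (H : TiltedPolygon n τ γ) : TiltedPolygon n (n - τ) (fun i => -γ (i + τ)) := by
  have hp : ∀ i, γ (i + τ) = γ (i + τ - n) := fun i => by
    rw [← H.periodic (i + τ - n), sub_add_cancel]
  have h1 := H.pos
  have h2 := H.lt
  refine ⟨by omega, by omega, fun i => ?_, fun i j hij hj => ?_, fun i j hi hij hj => ?_,
    fun i j hi hij hj => ?_, fun i j k hi hij hj hk => ?_, fun i j k hi hij hj hk => ?_, ?_⟩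
  · simp only [← H.periodic (i + τ)]
    congr 2; ring
  · simpa using H.ne (i + τ) (j + τ) (by omega) (by omega)
  · simp only [hp]
    simpa using H.y_left (i + τ - n) (j + τ - n) (by omega) (by omega) (by omega)
  · simpa using H.y_right (i + τ) (j + τ) (by omega) (by omega) (by omega)
  · simp only [hp]
    have := H.x_left (i + τ - n) (j + τ - n) (k + τ - n) (by omega) (by omega) (by omega)
      (by omega)
    simpa [lt_max_iff, min_lt_iff] using this
  · have := H.x_right (i + τ) (j + τ) (k + τ) (by omega) (by omega) (by omega) (by omega)
    simpa [lt_max_iff, min_lt_iff] using this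
  · have := H.tilt
    have h3 := H.periodic 0
    simp only [zero_add] at *
    rw [sub_add_cancel, h3]
    simpa using this

theorem y_zero_lt (H : TiltedPolygon n τ γ) {i : ℤ} (h1 : τ - n ≤ i) (h2 : i ≤ τ) (h3 : i ≠ 0) :
    (γ 0).2 < (γ i).2 := by
  rcases lt_or_gt_of_ne h3 with h | h
  · exact H.y_left i 0 h1 h le_rfl
  · exact H.y_right 0 i le_rfl h h2

theorem x_zero_lt (H : TiltedPolygon n τ γ) {i : ℤ} (h1 : 0 < i) (h2 : i ≤ τ) :
    (γ 0).1 < (γ i).1 := by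
  rcases eq_or_ne i τ with rfl | h
  · exact H.tilt
  · have := H.x_right 0 i τ le_rfl h1 (by omega) le_rfl
    rwa [min_eq_left H.tilt.le] at this

theorem eq_top (H : TiltedPolygon n τ γ) : γ (τ - n) = γ τ := by
  rw [← H.periodic (τ - n), sub_add_cancel]

theorem x_lt_top (H : TiltedPolygon n τ γ) {i : ℤ} (h1 : τ - n < i) (h2 : i ≤ 0) :
    (γ i).1 < (γ τ).1 := by
  rcases eq_or_ne i 0 with rfl | h
  · exact H.tilt
  · have := H.x_left (τ - n) i 0 le_rfl h1 (by omega) le_rfl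
    rwa [H.eq_top, max_eq_left H.tilt.le] at this

theorem exists_isShadow (H : TiltedPolygon n τ γ) : ∃ q, IsShadow n τ γ q := by
  have h1 := H.pos
  have h2 := H.lt
  obtain ⟨k, h3, h4, h5, h6⟩ := exists_run_start (fun i => (γ i).1 ≤ (γ 0).1)
    (a := τ - n + 1) (b := 0) (by omega) le_rfl
  have h7 : (γ 0).1 < (γ (k - 1)).1 := by
    rcases h6 with h6 | h6
    · rw [h6, add_sub_cancel_right, H.eq_top]; exact H.tilt
    · exact not_le.1 h6
  refine ⟨1 - k, by omega, by omega, fun i hi hi' => h5 i (by omega) hi', fun i hi hi' => ?_⟩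
  rcases eq_or_ne i (k - 1) with rfl | h
  · exact h7
  · have := H.x_left i (k - 1) 0 hi (by omega) (by omega) le_rfl
    rw [lt_max_iff] at this
    rcases this with h8 | h8 <;> linarith

theorem x_left_anti (H : TiltedPolygon n τ γ) {q : ℤ} (hq : IsShadow n τ γ q) {i j : ℤ}
    (h1 : τ - n ≤ i) (h2 : i < j) (h3 : j ≤ -q) : (γ j).1 < (γ i).1 := by
  have := H.x_left i j 0 h1 h2 (by have := hq.1; omega) le_rfl
  rw [lt_max_iff] at this
  have h4 := hq.2.2.2 j (by omega) h3
  rcases this with h | h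
  · exact h
  · linarith

theorem comparable (H : TiltedPolygon n τ γ) (l : Direction) {i j : ℤ} (h1 : i < j)
    (h2 : j < i + n) : PointsIn l (γ i) (γ j) ∨ PointsIn l (γ j) (γ i) := by
  have := H.ne i j h1 h2
  cases l <;> simp only [PointsIn]
  · exact lt_or_gt_of_ne this.2
  · exact lt_or_gt_of_ne this.2.symm
  · exact lt_or_gt_of_ne this.1.symm
  · exact lt_or_gt_of_ne this.1

/-- Any path without the label `L` can be placed on any interval of the left chain, so that its last
vertex is extreme in the direction of the last edge: this extreme point is always an end of the
interval, and the preceding vertices are placed on the other points. -/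
theorem greedy (H : TiltedPolygon n τ γ) (he : ∀ s, e s ≠ Direction.L) (k : ℕ) :
    ∀ x y : ℤ, τ - n ≤ x → y ≤ 0 → y - x = k → ∃ c, (c = x ∨ c = y) ∧
      Sweep (StepRel e γ) x y c ∧
      ∀ i, x ≤ i → i ≤ y → i ≠ c → PointsIn (e (y - x - 1)) (γ i) (γ c) := by
  induction k with
  | zero =>
    intro x y _ _ h
    obtain rfl : y = x := by omega
    exact ⟨y, .inl rfl, .single y, fun i h1 h2 h3 => absurd (le_antisymm h2 h1) h3⟩
  | succ k ih =>
    intro x y hx hy hk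
    push_cast at hk
    have goLeft : (∀ i, x < i → i ≤ y → PointsIn (e (y - x - 1)) (γ i) (γ x)) →
        ∃ c, (c = x ∨ c = y) ∧ Sweep (StepRel e γ) x y c ∧
          ∀ i, x ≤ i → i ≤ y → i ≠ c → PointsIn (e (y - x - 1)) (γ i) (γ c) := by
      intro hmax
      obtain ⟨c, -, h1, -⟩ := ih (x + 1) y (by omega) hy (by omega)
      have := h1.mem_Icc
      refine ⟨x, .inl rfl, h1.extend_left (by ring) ?_, fun i h2 h3 h4 => hmax i (by omega) h3⟩
      rw [show y - (x + 1) = y - x - 1 by ring]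
      exact hmax c (by omega) (by omega)
    have goRight : (∀ i, x ≤ i → i < y → PointsIn (e (y - x - 1)) (γ i) (γ y)) →
        ∃ c, (c = x ∨ c = y) ∧ Sweep (StepRel e γ) x y c ∧
          ∀ i, x ≤ i → i ≤ y → i ≠ c → PointsIn (e (y - x - 1)) (γ i) (γ c) := by
      intro hmax
      obtain ⟨c, -, h1, -⟩ := ih x (y - 1) hx (by omega) (by omega)
      have := h1.mem_Icc
      refine ⟨y, .inr rfl, h1.extend_right (by ring) ?_, fun i h2 h3 h4 => hmax i h2 (by omega)⟩
      rw [show y - 1 - x = y - x - 1 by ring]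
      exact hmax c (by omega) (by omega)
    cases hl : e (y - x - 1) with
    | U => exact hl ▸ goLeft (fun i h1 h2 => by rw [hl]; exact H.y_left x i hx h1 (by omega))
    | D => exact hl ▸ goRight (fun i h1 h2 => by rw [hl]; exact H.y_left i y (by omega) h2 hy)
    | L => exact absurd hl (he _)
    | R =>
      have hxy := (H.ne x y (by omega) (by have := H.pos; omega)).1
      rcases lt_or_gt_of_ne hxy with h | h
      · refine hl ▸ goRight (fun i h1 h2 => ?_)
        rw [hl]
        rcases eq_or_ne i x with rfl | hne
        · exact h
        · have := H.x_left x i y hx (by omega) h2 hy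
          rwa [max_eq_right h.le] at this
      · refine hl ▸ goLeft (fun i h1 h2 => ?_)
        rw [hl]
        rcases eq_or_ne i y with rfl | hne
        · exact h
        · have := H.x_left x i y hx h1 (by omega) hy
          rwa [max_eq_left h.le] at this

/-- A part of the path preceding a run of `U` and not larger than the shadow can be placed so as to
end at the lowest vertex: its last edge is labelled `D` or `R`, and within the shadow the lowest
vertex is extreme in both directions. -/
theorem bottom_start (H : TiltedPolygon n τ γ) (he : ∀ s, e s ≠ Direction.L) {q k : ℤ}
    (hq : IsShadow n τ γ q) (h0 : 0 ≤ k) (hk : k < q) (hU : k = 0 ∨ e (k - 1) ≠ Direction.U) :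
    Sweep (StepRel e γ) (-k) 0 0 := by
  obtain ⟨hq1, hq2, hq3, hq4⟩ := hq
  obtain ⟨c, hc, h1, h2⟩ := H.greedy he k.toNat (-k) 0 (by omega) le_rfl (by omega)
  rcases hc with rfl | rfl
  · rcases eq_or_ne k 0 with rfl | hk0
    · simpa using h1
    · have h3 := h2 0 (by omega) le_rfl (by omega)
      rw [show 0 - -k - 1 = k - 1 by ring] at h3
      cases hl : e (k - 1) with
      | U => exact absurd hl (hU.resolve_left hk0)
      | D =>
        rw [hl] at h3
        exact absurd h3 (lt_asymm
          (H.y_zero_lt (i := -k) (by omega) (by have := H.pos; omega) (by omega)))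
      | L => exact absurd hl (he _)
      | R =>
        rw [hl] at h3
        exact absurd h3 (not_lt.2 (hq3 _ (by omega) (by omega)))
  · exact h1

/-- The first part of the path covers the shadow, the left chain down from index `-α`, and some
vertices `1, …, β` of the right chain, in such a way that the next edge can go to every remaining
vertex of the left chain and to every remaining vertex of the right chain up to index `C`. The last
clause describes when the next edge can moreover reach the corresponding vertex of the rotated
copy of this construction. -/
theorem front (H : TiltedPolygon n τ γ) (he : ∀ s, e s ≠ Direction.L) {q α C : ℤ}
    (hq : IsShadow n τ γ q) (hα1 : q - 1 ≤ α) (hα2 : α ≤ n - τ - 1)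
    (hα3 : α = q - 1 ∨ q ≤ α ∧ e (α - 1) = Direction.D) (hC0 : 0 ≤ C) (hC : C < τ)
    (hD : ∀ s, α ≤ s → s ≤ α + C → e s ≠ Direction.D) :
    ∃ β c, 0 ≤ β ∧ β ≤ C ∧ Sweep (StepRel e γ) (-α) β c ∧ -q < c ∧ c ≤ 0 ∧
      (∀ i, (τ - n < i ∧ i < -α) ∨ (β < i ∧ i ≤ C) → PointsIn (e (α + β)) (γ c) (γ i)) ∧
      (e (α + β) = Direction.R ∨ c = 0 ∨ ∀ s, q - 1 ≤ s → s ≤ α + β → e s = Direction.U) := by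
  have hpos := H.pos
  obtain ⟨hq1, hq2, hq3, hq4⟩ := id hq
  have hxout : ∀ c i, -q < c → c ≤ 0 → (τ - n < i ∧ i < -α) ∨ (0 < i ∧ i ≤ C) →
      (γ c).1 < (γ i).1 := by
    intro c i h1 h2 h3
    refine (hq3 c h1 h2).trans_lt ?_
    rcases h3 with h3 | h3
    · exact hq4 i (by omega) (by omega)
    · exact H.x_zero_lt h3.1 (by omega)
  have hzero : ∀ l, l ≠ Direction.L → l ≠ Direction.D → ∀ i,
      (τ - n < i ∧ i < -α) ∨ (0 < i ∧ i ≤ C) → PointsIn l (γ 0) (γ i) := by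
    intro l h1 h2 i h3
    cases l with
    | U => exact H.y_zero_lt (by omega) (by omega) (by omega)
    | D => exact absurd rfl h2
    | L => exact absurd rfl h1
    | R => exact hxout 0 i (by omega) le_rfl h3
  have hDα := hD α le_rfl (by omega)
  rcases hα3 with hα3 | hα3
  · cases hl : e α with
    | L => exact absurd hl (he _)
    | D => exact absurd hl hDα
    | R =>
      obtain ⟨c, hc, h1, -⟩ := H.greedy he α.toNat (-α) 0 (by omega) le_rfl (by omega)
      refine ⟨0, c, le_rfl, hC0, h1, by omega, by omega, fun i hi => ?_, .inl (by simpa)⟩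
      rw [add_zero, hl]
      exact hxout c i (by omega) (by omega) hi
    | U =>
      obtain ⟨k, hk1, hk2, hk3, hk4⟩ := exists_run_start (fun s => e s = Direction.U)
        (a := 0) (b := α) (by omega) hl
      have hs := H.bottom_start he hq hk1 (by omega) hk4
      rcases hk2.eq_or_lt with rfl | hk2
      · refine ⟨0, 0, le_rfl, hC0, hs, by omega, le_rfl, fun i hi => ?_, .inr (.inl rfl)⟩
        rw [add_zero]
        exact hzero _ (he _) hDα i hi
      · -- `β` is the largest number for which `1, …, β` lie below `-α` and the run of `U` is long
        -- enough to reach `-α` after them; it is found as a run start on the negative side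
        obtain ⟨b, hb1, hb2, hb3, hb4⟩ := exists_run_start
          (fun s => s = 0 ∨ ((γ (-s)).2 < (γ (-α)).2 ∧ e (α - s - 1) = Direction.U))
          (a := -C) (b := 0) (by omega) (.inl rfl)
        obtain ⟨β, rfl⟩ : ∃ β, b = -β := ⟨-b, by ring⟩
        have hβ : ∀ i, 0 < i → i ≤ β → (γ i).2 < (γ (-α)).2 ∧ e (α + i - 1) = Direction.U := by
          intro i h1 h2
          have := hb3 (-i) (by omega) (by omega)
          rw [neg_neg, sub_neg_eq_add] at this
          exact this.resolve_left (by omega)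
        have hUs : ∀ s, k ≤ s → s ≤ α ∨ s < α + β → e s = Direction.U := by
          intro s h1 h2
          by_cases h3 : s ≤ α
          · exact hk3 s h1 h3
          · have := (hβ (s - α + 1) (by omega) (by omega)).2
            rwa [show α + (s - α + 1) - 1 = s by ring] at this
        -- the vertex `-α` is left out here and visited last: it is to the left of everything outside
        -- the shadow, so that the next edge may be labelled `R`
        obtain ⟨c', h1, h2⟩ := Sweep.exists_merge {Direction.U} (α - 1 - k + β).toNat
          (x' := 1 - α) (y' := β) hs (by omega) (by omega) (by omega)
          (by
            rintro _ rfl i j h1 h2 h3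
            exact H.y_left j i (by omega) h2 (by omega))
          (by
            rintro _ rfl i j h1 h2 h3
            exact H.y_right i j (by omega) h2 (by omega))
          (fun l _ i j h1 h2 h3 h4 => H.comparable l (by omega) (by omega))
          (fun s h1 h2 => hUs s (by omega) (by omega))
          (fun i hi => by
            rw [show (0 : ℤ) - -k = k by ring, hk3 k le_rfl (by omega)]
            exact H.y_zero_lt (by omega) (by omega) (by omega))
        have h3 : (γ c').2 < (γ (-α)).2 := by
          by_cases h : 0 < c'
          · exact (hβ c' h (by omega)).1
          · exact H.y_left _ _ (by omega) (by omega) (by omega)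
        refine ⟨β, -α, by omega, by omega, h1.extend_left (by ring) ?_, by omega, by omega,
          fun i hi => ?_, ?_⟩
        · show PointsIn _ _ _
          rw [hUs _ (by omega) (by omega)]
          exact h3
        · cases hl' : e (α + β) with
          | L => exact absurd hl' (he _)
          | D => exact absurd hl' (hD _ (by omega) (by omega))
          | R => exact hxout _ _ (by omega) (by omega) (by omega)
          | U =>
            rcases hi with hi | hi
            · exact H.y_left _ _ (by omega) (by omega) (by omega)
            · have h4 : ¬ (γ (β + 1)).2 < (γ (-α)).2 := by
                intro h5
                rcases hb4 with hb4 | hb4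
                · omega
                · refine hb4 (.inr ?_)
                  rw [show -(-β - 1) = β + 1 by ring, show α - (-β - 1) - 1 = α + β by ring]
                  exact ⟨h5, hl'⟩
              have h5 := (H.ne (-α) (β + 1) (by omega) (by omega)).2
              have h6 : (γ (-α)).2 < (γ (β + 1)).2 := lt_of_le_of_ne (not_lt.1 h4) h5
              rcases eq_or_ne i (β + 1) with rfl | hne
              · exact h6
              · exact h6.trans (H.y_right _ _ (by omega) (by omega) (by omega))
        · cases hl' : e (α + β) with
          | L => exact absurd hl' (he _)
          | D => exact absurd hl' (hD _ (by omega) (by omega))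
          | R => exact .inl rfl
          | U =>
            refine .inr (.inr fun s h4 h5 => ?_)
            rcases h5.eq_or_lt with rfl | h5
            · exact hl'
            · exact hUs s (by omega) (by omega)
  · obtain ⟨c, hc, h1, h2⟩ := H.greedy he α.toNat (-α) 0 (by omega) le_rfl (by omega)
    have hc0 : c = 0 := by
      rcases hc with rfl | rfl
      · have h3 := h2 0 (by omega) le_rfl (by omega)
        rw [show 0 - -α - 1 = α - 1 by ring, hα3.2] at h3
        exact absurd h3 (lt_asymm (H.y_zero_lt (by omega) (by omega) (by omega)))
      · rfl
    subst hc0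
    refine ⟨0, 0, le_rfl, hC0, h1, by omega, le_rfl, fun i hi => ?_, .inr (.inl rfl)⟩
    rw [add_zero]
    exact hzero _ (he _) hDα i hi

/-! ### Combining the two ends -/

theorem join (H : TiltedPolygon n τ γ) {x y c x' y' d : ℤ} (h : Sweep (StepRel e γ) x y c)
    (h' : Sweep (StepRel (fun s => e (n - 2 - s)) (fun i => -γ (i + τ))) x' y' d)
    (hx : x' + τ = y + 1) (hy : y' + τ = x - 1 + n)
    (hr : PointsIn (e (y - x)) (γ c) (γ (d + τ))) :
    ∃ x c, Sweep (StepRel e γ) x (x + n - 1) c := by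
  refine Sweep.join (r := StepRel e γ) (n := n) (τ := τ) (fun s i j => ?_) (fun s i j => ?_)
    (x' := x') (y' := y') (d := d) ?_ h hx hy hr
  · simp only [StepRel, H.periodic]
  · simp only [StepRel, H.periodic]
  · convert h' using 4
    simp only [StepRel, pointsIn_neg]

/-- The maximal run of `D` through the edge leaving the left chain starts at the highest vertex and
ends at the lowest one. -/
theorem traverse_of_down (H : TiltedPolygon n τ γ) (he : ∀ s, e s ≠ Direction.L)
    (hD : e (n - τ - 1) = Direction.D) : ∃ x c, Sweep (StepRel e γ) x (x + n - 1) c := by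
  have top_start : ∀ {τ : ℤ} {γ : ℤ → ℝ × ℝ} {e : ℤ → Direction}, TiltedPolygon n τ γ →
      (∀ s, e s ≠ Direction.L) → e (n - τ - 1) = Direction.D →
      ∃ k, 0 ≤ k ∧ k ≤ n - τ - 1 ∧ (∀ s, k ≤ s → s ≤ n - τ - 1 → e s = Direction.D) ∧
        Sweep (StepRel e γ) (τ - n) (τ - n + k) (τ - n) := by
    intro τ γ e H he hD
    have hpos := H.pos
    have hlt := H.lt
    obtain ⟨k, hk1, hk2, hk3, hk4⟩ := exists_run_start (fun s => e s = Direction.D)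
      (a := 0) (b := n - τ - 1) (by omega) hD
    refine ⟨k, hk1, hk2, hk3, ?_⟩
    obtain ⟨c, hc, h1, h2⟩ := H.greedy he k.toNat (τ - n) (τ - n + k) le_rfl (by omega) (by omega)
    rcases hc with rfl | rfl
    · exact h1
    · rcases eq_or_ne k 0 with rfl | hk0
      · simpa using h1
      · have h3 := h2 (τ - n) le_rfl (by omega) (by omega)
        rw [show τ - n + k - (τ - n) - 1 = k - 1 by ring] at h3
        cases hl : e (k - 1) with
        | D => exact absurd hl (hk4.resolve_left hk0)
        | L => exact absurd hl (he _)
        | U =>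
          rw [hl] at h3
          exact absurd h3 (lt_asymm (H.y_left (τ - n) (τ - n + k) le_rfl (by omega) (by omega)))
        | R =>
          rw [hl] at h3
          have := H.x_lt_top (i := τ - n + k) (by omega) (by omega)
          rw [← H.eq_top] at this
          exact absurd h3 (lt_asymm this)
  have hpos := H.pos
  have hlt := H.lt
  obtain ⟨k, hk1, hk2, hk3, hs⟩ := top_start H he hD
  obtain ⟨k', hk1', hk2', hk3', hs'⟩ := top_start H.rotate (e := fun s => e (n - 2 - s))
    (fun s => he _) (by rw [← hD]; congr 1; ring)
  have hp : ∀ i, γ i = γ (i + n) := fun i => (H.periodic i).symm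
  have hrun : ∀ s, k ≤ s → s ≤ n - 2 - k' → e s = Direction.D := by
    intro s h1 h2
    by_cases h3 : s ≤ n - τ - 1
    · exact hk3 s h1 h3
    · have := hk3' (n - 2 - s) (by omega) (by omega)
      rwa [sub_sub_cancel] at this
  obtain ⟨c, h1, h2⟩ := Sweep.exists_merge {Direction.D} (n - 2 - k - k').toNat
    (x' := k' + 1 - n) (y' := -1) hs (by omega) (by omega) (by omega)
    (by
      rintro _ rfl i j h1 h2 h3
      rw [hp i, hp j]
      exact H.y_right (j + n) (i + n) (by omega) (by omega) (by omega))
    (by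
      rintro _ rfl i j h1 h2 h3
      exact H.y_left i j (by omega) h2 (by omega))
    (fun l _ i j h1 h2 h3 h4 => H.comparable l (by omega) (by omega))
    (fun s h1 h2 => hrun s (by omega) (by omega))
    (fun i hi => by
      rw [hrun _ (by omega) (by omega)]
      rcases hi with hi | hi
      · rw [hp i, H.eq_top]
        exact H.y_right _ _ (by omega) (by omega) le_rfl
      · exact H.y_left _ _ le_rfl (by omega) (by omega))
  refine H.join h1 hs' (by omega) (by omega) ?_
  rw [show n - τ - n + τ = 0 by ring, hrun _ (by omega) (by omega)]
  by_cases h : c < τ - n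
  · show (γ 0).2 < (γ c).2
    rw [hp c]
    exact H.y_zero_lt (by omega) (by omega) (by omega)
  · exact H.y_zero_lt (by omega) (by omega) (by omega)

/-- A run of `U` covers all edges between the two shadows. It starts at the lowest vertex and ends at
the highest one. -/
theorem traverse_of_up (H : TiltedPolygon n τ γ) (he : ∀ s, e s ≠ Direction.L) {q q' : ℤ}
    (hq : IsShadow n τ γ q) (hq' : IsShadow n (n - τ) (fun i => -γ (i + τ)) q')
    (hU : ∀ s, q - 1 ≤ s → s ≤ n - 1 - q' → e s = Direction.U) :
    ∃ x c, Sweep (StepRel e γ) x (x + n - 1) c := by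
  have hpos := H.pos
  have hlt := H.lt
  obtain ⟨hq1, hq2, hq3, hq4⟩ := id hq
  obtain ⟨hq1', hq2', hq3', hq4'⟩ := id hq'
  obtain ⟨k, hk1, hk2, hk3, hk4⟩ := exists_run_start (fun s => e s = Direction.U)
    (a := 0) (b := q - 1) (by omega) (hU _ le_rfl (by omega))
  obtain ⟨k', hk1', hk2', hk3', hk4'⟩ := exists_run_start (fun s => e (n - 2 - s) = Direction.U)
    (a := 0) (b := q' - 1) (by omega) (hU _ (by omega) (by omega))
  have hs := H.bottom_start he hq hk1 (by omega) hk4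
  have hs' := H.rotate.bottom_start (e := fun s => e (n - 2 - s)) (fun s => he _) hq' hk1'
    (by omega) hk4'
  have hrun : ∀ s, k ≤ s → s ≤ n - 2 - k' → e s = Direction.U := by
    intro s h1 h2
    by_cases h3 : s ≤ q - 1
    · exact hk3 s h1 h3
    by_cases h4 : s ≤ n - 1 - q'
    · exact hU s (by omega) h4
    · have := hk3' (n - 2 - s) (by omega) (by omega)
      rwa [sub_sub_cancel] at this
  obtain ⟨c, h1, h2⟩ := Sweep.exists_merge {Direction.U} (n - 2 - k - k').toNat (x' := τ + 1 - n)
    (y' := τ - 1 - k') hs (by omega) (by omega) (by omega)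
    (by
      rintro _ rfl i j h1 h2 h3
      exact H.y_left j i (by omega) h2 (by omega))
    (by
      rintro _ rfl i j h1 h2 h3
      exact H.y_right i j (by omega) h2 (by omega))
    (fun l _ i j h1 h2 h3 h4 => H.comparable l (by omega) (by omega))
    (fun s h1 h2 => hrun s (by omega) (by omega))
    (fun i hi => by
      rw [hrun _ (by omega) (by omega)]
      exact H.y_zero_lt (by omega) (by omega) (by omega))
  refine H.join h1 hs' (by omega) (by omega) ?_
  rw [zero_add, hrun _ (by omega) (by omega)]
  by_cases h : c ≤ 0
  · rw [← H.eq_top]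
    exact H.y_left _ _ le_rfl (by omega) (by omega)
  · exact H.y_right _ _ (by omega) (by omega) (by omega)

theorem traverse (H : TiltedPolygon n τ γ) (he : ∀ s, e s ≠ Direction.L) :
    ∃ x c, Sweep (StepRel e γ) x (x + n - 1) c := by
  have hpos := H.pos
  have hlt := H.lt
  by_cases hD : e (n - τ - 1) = Direction.D
  · exact H.traverse_of_down he hD
  obtain ⟨q, hq⟩ := H.exists_isShadow
  obtain ⟨q', hq'⟩ := H.rotate.exists_isShadow
  by_cases hU : ∀ s, q - 1 ≤ s → s ≤ n - 1 - q' → e s = Direction.U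
  · exact H.traverse_of_up he hq hq' hU
  obtain ⟨hq1, hq2, hq3, hq4⟩ := id hq
  obtain ⟨hq1', hq2', hq3', hq4'⟩ := id hq'
  have he' : ∀ s, e (n - 2 - s) ≠ Direction.L := fun s => he _
  -- `α` exceeds `q - 1` only if a `D` occurs after the shadow is filled, which forces the first
  -- part to stay on the left chain until then
  obtain ⟨α, ha1, ha2, ha3, ha4⟩ := exists_run_start (fun s => e s ≠ Direction.D)
    (a := q - 1) (b := n - τ - 1) (by omega) hD
  obtain ⟨α', ha1', ha2', ha3', ha4'⟩ := exists_run_start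
    (fun s => e (n - 2 - s) ≠ Direction.D) (a := q' - 1) (b := n - (n - τ) - 1) (by omega)
    (by rwa [show n - 2 - (n - (n - τ) - 1) = n - τ - 1 by ring])
  have hrun : ∀ s, α ≤ s → s ≤ n - 2 - α' → e s ≠ Direction.D := by
    intro s h1 h2
    by_cases h3 : s ≤ n - τ - 1
    · exact ha3 s h1 h3
    · have := ha3' (n - 2 - s) (by omega) (by omega)
      rwa [sub_sub_cancel] at this
  obtain ⟨β, c, hb1, hb2, hs, hc1, hc2, hc3, hc4⟩ := H.front he (C := τ - 1 - α') hq ha1 ha2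
    (or_iff_not_imp_left.2 fun h => ⟨by omega, not_not.1 (ha4.resolve_left h)⟩)
    (by omega) (by omega)
    (fun s h1 h2 => hrun s h1 (by omega))
  obtain ⟨β', d, hb1', hb2', hs', hd1, hd2, hd3, hd4⟩ := H.rotate.front he' (C := n - τ - 1 - α)
    hq' ha1' ha2'
    (or_iff_not_imp_left.2 fun h => ⟨by omega, not_not.1 (ha4'.resolve_left h)⟩)
    (by omega) (by omega)
    (fun s h1 h2 => hrun _ (by omega) (by omega))
  have hUR : ∀ s, α ≤ s → s ≤ n - 2 - α' → e s ∈ ({Direction.U, Direction.R} : Set Direction) := by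
    intro s h1 h2
    have h3 := hrun s h1 h2
    have h4 := he s
    cases h : e s <;> simp_all
  simp only [pointsIn_neg] at hd3
  obtain ⟨c', h1, h2⟩ := Sweep.exists_merge {Direction.U, Direction.R}
    (n - 2 - α - β - α' - β').toNat
    (x' := τ + β' + 1 - n) (y' := τ - 1 - α') hs (by omega) (by omega) (by omega)
    (by
      rintro _ (rfl | rfl) i j h1 h2 h3
      · exact H.y_left j i (by omega) h2 (by omega)
      · exact H.x_left_anti hq (by omega) h2 (by omega))
    (by
      rintro _ (rfl | rfl) i j h1 h2 h3
      · exact H.y_right i j (by omega) h2 (by omega)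
      · have := H.rotate.x_left_anti hq' (i := i - τ) (j := j - τ) (by omega) (by omega) (by omega)
        show (γ i).1 < (γ j).1
        simpa using this)
    (fun l _ i j h1 h2 h3 h4 => H.comparable l (by omega) (by omega))
    (fun s h1 h2 => hUR s (by omega) (by omega))
    (fun i hi => by
      rw [show β - -α = α + β by ring]
      exact hc3 i (by omega))
  refine H.join h1 hs' (by omega) (by omega) ?_
  have hlab : τ - 1 - α' - (τ + β' + 1 - n) = n - 2 - (α' + β') := by ring
  have hp : ∀ i, γ i = γ (i + n) := fun i => (H.periodic i).symm
  rw [hlab]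
  rcases h2 with ⟨rfl, h3, h4⟩ | h2 | h2
  · -- no vertices are left in the middle
    have hsum : n - 2 - (α' + β') = α + β := by omega
    rw [hsum] at hd4 ⊢
    have hR : PointsIn Direction.R (γ c') (γ (d + τ)) := by
      have h5 := hq3 c' hc1 hc2
      have h6 := hq3' d hd1 hd2
      simp only [zero_add] at h6
      have h7 : (γ τ).1 ≤ (γ (d + τ)).1 := by simpa using h6
      exact (h5.trans_lt H.tilt).trans_le h7
    rcases hUR (α + β) (by omega) (by omega) with hl | hl
    · rw [hl]
      rcases hc4 with h5 | rfl | h5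
      · rw [hl] at h5; cases h5
      · exact H.y_zero_lt (by omega) (by omega) (by omega)
      · rcases hd4 with h6 | rfl | h6
        · rw [hl] at h6; cases h6
        · rw [zero_add, ← H.eq_top]
          exact H.y_left _ _ le_rfl (by omega) (by omega)
        · -- both ends stop inside the same run of `U`, which therefore covers everything between
          refine absurd (fun s h7 h8 => ?_) hU
          by_cases h9 : s ≤ α + β
          · exact h5 s h7 h9
          · have := h6 (n - 2 - s) (by omega) (by omega)
            rwa [sub_sub_cancel] at this
    · rw [Set.mem_singleton_iff.1 hl]
      exact hR
  · have := hd3 (c' + n - τ) (by omega)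
    rwa [show c' + n - τ + τ = c' + n by ring, ← hp] at this
  · have := hd3 (c' - τ) (by omega)
    rwa [sub_add_cancel] at this

end TiltedPolygon

/-! ### Convex polygons -/

/-- Twice the signed area of the triangle `a b c`; positive if it is counterclockwise. -/
def orient (a b c : ℝ × ℝ) : ℝ :=
  (b.1 - a.1) * (c.2 - a.2) - (b.2 - a.2) * (c.1 - a.1)

theorem orient_rotate (a b c : ℝ × ℝ) : orient b c a = orient a b c := by
  simp only [orient]; ring

theorem orient_swap (a b c : ℝ × ℝ) : orient b a c = -orient a b c := by
  simp only [orient]; ring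

/-- `γ` runs periodically and counterclockwise through the vertices of a strictly convex `n`-gon
with pairwise distinct `x`- and `y`-coordinates. -/
structure ConvexPolygon (n : ℤ) (γ : ℤ → ℝ × ℝ) : Prop where
  periodic : ∀ i, γ (i + n) = γ i
  ne : ∀ i j, i < j → j < i + n → (γ i).1 ≠ (γ j).1 ∧ (γ i).2 ≠ (γ j).2
  ccw : ∀ i j k, i < j → j < k → k < i + n → 0 < orient (γ i) (γ j) (γ k)

/-- The effect of the counterclockwise quarter turn `(x, y) ↦ (-y, x)` on directions. -/
def Direction.rot : Direction → Direction
  | U => L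
  | L => D
  | D => R
  | R => U

/-- The effect of the reflection `(x, y) ↦ (x, -y)` on directions. -/
def Direction.flip : Direction → Direction
  | U => D
  | D => U
  | L => L
  | R => R

namespace ConvexPolygon

variable {n : ℤ} {γ : ℤ → ℝ × ℝ} {e : ℤ → Direction}

theorem shift (G : ConvexPolygon n γ) (b : ℤ) : ConvexPolygon n (fun i => γ (i + b)) where
  periodic i := by rw [← G.periodic (i + b)]; congr 1; ring
  ne i j h1 h2 := G.ne _ _ (by omega) (by omega)
  ccw i j k h1 h2 h3 := G.ccw _ _ _ (by omega) (by omega) (by omega)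

/-- A reflection reverses the orientation, which the negation of the indices restores. -/
theorem reflect (G : ConvexPolygon n γ) :
    ConvexPolygon n (fun i => ((γ (-i)).1, -(γ (-i)).2)) where
  periodic i := by
    have : γ (-(i + n)) = γ (-i) := by rw [← G.periodic (-(i + n))]; congr 1; ring
    simp only [this]
  ne i j h1 h2 := by
    have := G.ne (-j) (-i) (by omega) (by omega)
    simpa [eq_comm] using this
  ccw i j k h1 h2 h3 := by
    have := G.ccw (-k) (-j) (-i) (by omega) (by omega) (by omega)
    simp only [orient] at *
    linarith

theorem rot (G : ConvexPolygon n γ) : ConvexPolygon n (fun i => (-(γ i).2, (γ i).1)) where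
  periodic i := by simp only [G.periodic]
  ne i j h1 h2 := by
    have := G.ne i j h1 h2
    simpa [and_comm] using this
  ccw i j k h1 h2 h3 := by
    have := G.ccw i j k h1 h2 h3
    simp only [orient] at *
    linarith

theorem apply_emod (G : ConvexPolygon n γ) (i : ℤ) : γ (i % n) = γ i := by
  have hper : Function.Periodic γ n := G.periodic
  rw [Int.emod_def, mul_comm]
  exact (hper.int_mul _).sub_eq _

theorem tilted (G : ConvexPolygon n γ) {τ : ℤ} (h0 : 0 < τ) (hn : τ < n)
    (hb : ∀ i, (γ 0).2 ≤ (γ i).2) (ht : ∀ i, (γ i).2 ≤ (γ τ).2) (hx : (γ 0).1 < (γ τ).1) :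
    TiltedPolygon n τ γ := by
  have htop : γ (τ - n) = γ τ := by rw [← G.periodic (τ - n), sub_add_cancel]
  have hbot : ∀ i, -n < i → i < n → i ≠ 0 → (γ 0).2 < (γ i).2 := fun i h1 h2 h3 =>
    lt_of_le_of_ne (hb i) (by
      rcases lt_or_gt_of_ne h3 with h | h
      · exact (G.ne i 0 h (by omega)).2.symm
      · exact (G.ne 0 i h (by omega)).2)
  have htop' : ∀ i, τ - n < i → i < τ → (γ i).2 < (γ τ).2 := fun i h1 h2 =>
    lt_of_le_of_ne (ht i) (G.ne i τ h2 (by omega)).2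
  have yr : ∀ i j, 0 ≤ i → i < j → j ≤ τ → (γ i).2 < (γ j).2 := by
    intro i j h1 h2 h3
    rcases h1.eq_or_lt with rfl | h1
    · exact hbot j (by omega) (by omega) (by omega)
    rcases h3.eq_or_lt with rfl | h3
    · exact htop' i (by omega) h2
    -- the area relation between `0, i, j, τ` expresses the barycenter of `0, j` with positive
    -- weights as one of `i, τ`
    have e1 := G.ccw i j τ h2 h3 (by omega)
    have e2 := G.ccw 0 i j h1 h2 (by omega)
    have e3 := G.ccw 0 i τ h1 (by omega) (by omega)
    have e4 := hbot i (by omega) (by omega) (by omega)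
    have e5 := htop' i (by omega) (by omega)
    by_contra hcon
    have f1 := mul_pos (sub_pos.2 e5) e2
    have f2 := mul_pos (sub_pos.2 e4) e1
    have f3 := mul_nonneg (sub_nonneg.2 (not_lt.1 hcon)) e3.le
    simp only [orient] at *
    linarith
  have yl : ∀ i j, τ - n ≤ i → i < j → j ≤ 0 → (γ j).2 < (γ i).2 := by
    intro i j h1 h2 h3
    rcases h1.eq_or_lt with rfl | h1
    · rw [htop]
      exact htop' j (by omega) (by omega)
    rcases h3.eq_or_lt with rfl | h3
    · exact hbot i (by omega) (by omega) (by omega)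
    have e1 := G.ccw i j 0 h2 h3 (by omega)
    have e2 := G.ccw (τ - n) i j h1 h2 (by omega)
    have e3 := G.ccw (τ - n) i 0 h1 (by omega) (by omega)
    have e4 := hbot i (by omega) (by omega) (by omega)
    have e5 := htop' i (by omega) (by omega)
    rw [htop] at e2 e3
    by_contra hcon
    have f1 := mul_pos (sub_pos.2 e4) e2
    have f2 := mul_pos (sub_pos.2 e5) e1
    have f3 := mul_nonneg (sub_nonneg.2 (not_lt.1 hcon)) e3.le
    simp only [orient] at *
    linarith
  refine ⟨h0, hn, G.periodic, G.ne, yr, yl, ?_, ?_, hx⟩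
  · intro i j k h1 h2 h3 h4
    have e1 := G.ccw i j k h2 h3 (by omega)
    have e2 := yr i j h1 h2 (by omega)
    have e3 := yr j k (by omega) h3 h4
    by_contra hcon
    have hc := le_min_iff.1 (not_lt.1 hcon)
    have f1 := mul_nonneg (sub_nonneg.2 hc.1) (sub_nonneg.2 e3.le)
    have f2 := mul_nonneg (sub_nonneg.2 hc.2) (sub_nonneg.2 e2.le)
    simp only [orient] at *
    linarith
  · intro i j k h1 h2 h3 h4
    have e1 := G.ccw i j k h2 h3 (by omega)
    have e2 := yl i j h1 h2 (by omega)
    have e3 := yl j k (by omega) h3 h4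
    by_contra hcon
    have hc := max_le_iff.1 (not_lt.1 hcon)
    have f1 := mul_nonneg (sub_nonneg.2 hc.1) (sub_nonneg.2 e3.le)
    have f2 := mul_nonneg (sub_nonneg.2 hc.2) (sub_nonneg.2 e2.le)
    simp only [orient] at *
    linarith

theorem traverse_of_tilt (G : ConvexPolygon n γ) (hn : 2 ≤ n) (he : ∀ s, e s ≠ Direction.L)
    {b t : ℤ} (hb : ∀ i, (γ b).2 ≤ (γ i).2) (ht : ∀ i, (γ i).2 ≤ (γ t).2)
    (hx : (γ b).1 < (γ t).1) : ∃ x c, Sweep (StepRel e γ) x (x + n - 1) c := by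
  have hτ : γ ((t - b) % n + b) = γ t := by
    simpa using (G.shift b).apply_emod (t - b)
  have h0 : (t - b) % n ≠ 0 := fun h => by
    rw [h, zero_add] at hτ
    rw [hτ] at hx
    exact lt_irrefl _ hx
  obtain ⟨x, c, h⟩ := ((G.shift b).tilted (τ := (t - b) % n)
    (lt_of_le_of_ne (Int.emod_nonneg _ (by omega)) h0.symm) (Int.emod_lt_of_pos _ (by omega))
    (fun i => by rw [zero_add]; exact hb _) (fun i => by rw [hτ]; exact ht _)
    (by rwa [hτ, zero_add])).traverse he
  refine ⟨x + b, c + b, ?_⟩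
  have := Sweep.add_right (r := StepRel e γ) b h
  rwa [show x + n - 1 + b = x + b + n - 1 by ring] at this

theorem exists_bottom (G : ConvexPolygon n γ) (hn : 2 ≤ n) : ∃ b, ∀ i, (γ b).2 ≤ (γ i).2 := by
  obtain ⟨b, -, hb⟩ := Finset.exists_min_image (Finset.Ico 0 n) (fun i => (γ i).2)
    ⟨0, by simp; omega⟩
  refine ⟨b, fun i => ?_⟩
  have h1 := hb (i % n) (Finset.mem_Ico.2
    ⟨Int.emod_nonneg _ (by omega), Int.emod_lt_of_pos _ (by omega)⟩)
  rwa [G.apply_emod] at h1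

theorem traverse_of_ne_left (G : ConvexPolygon n γ) (hn : 2 ≤ n)
    (he : ∀ s, e s ≠ Direction.L) : ∃ x c, Sweep (StepRel e γ) x (x + n - 1) c := by
  obtain ⟨b, hb⟩ := G.exists_bottom hn
  obtain ⟨t, ht⟩ := G.reflect.exists_bottom hn
  have ht' : ∀ i, (γ i).2 ≤ (γ (-t)).2 := fun i => by simpa using ht (-i)
  rcases lt_trichotomy (γ b).1 (γ (-t)).1 with h | h | h
  · exact G.traverse_of_tilt hn he hb ht' h
  · have hd : γ (b + (-t - b) % n) = γ (-t) := by
      simpa [add_comm] using (G.shift b).apply_emod (-t - b)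
    have h0 := Int.emod_nonneg (-t - b) (b := n) (by omega)
    rcases h0.eq_or_lt with h0 | h0
    · rw [← h0, add_zero] at hd
      refine absurd ?_ (G.ne 0 1 one_pos (by omega)).2
      have h1 := hb 0
      have h2 := hb 1
      have h3 := ht' 0
      have h4 := ht' 1
      rw [← hd] at h3 h4
      linarith
    · have := Int.emod_lt_of_pos (-t - b) (b := n) (by omega)
      exact absurd (hd ▸ h) (G.ne b (b + (-t - b) % n) (by omega) (by omega)).1
  · obtain ⟨x, c, h1⟩ := G.reflect.traverse_of_tilt (e := fun s => (e s).flip) hn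
      (fun s => by have := he s; cases h : e s <;> simp_all [Direction.flip])
      (b := t) (t := -b) ht (fun i => by simpa using hb (-i)) (by simpa using h)
    refine ⟨-(x + n - 1), -c, ?_⟩
    rw [show -(x + n - 1) + n - 1 = -x by ring]
    refine Sweep.neg ?_
    convert h1 using 4 with s i j
    simp only [StepRel]
    cases e s <;> simp [PointsIn, Direction.flip]

theorem traverse (G : ConvexPolygon n γ) (hn : 2 ≤ n) {l : Direction} (he : ∀ s, e s ≠ l) :
    ∃ x c, Sweep (StepRel e γ) x (x + n - 1) c := by
  have hrot : ∀ {γ : ℤ → ℝ × ℝ} {e : ℤ → Direction},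
      StepRel (fun s => (e s).rot) (fun i => (-(γ i).2, (γ i).1)) = StepRel e γ := by
    intro γ e
    ext s i j
    simp only [StepRel]
    cases e s <;> simp [PointsIn, Direction.rot]
  have key : ∀ (k : ℕ) {γ : ℤ → ℝ × ℝ} {e : ℤ → Direction} {l : Direction}, ConvexPolygon n γ →
      (∀ s, e s ≠ l) → Direction.rot^[k] l = Direction.L →
      ∃ x c, Sweep (StepRel e γ) x (x + n - 1) c := by
    intro k
    induction k with
    | zero =>
      rintro γ e l G he rfl
      exact G.traverse_of_ne_left hn he
    | succ k ih =>
      intro γ e l G he hl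
      rw [← hrot]
      refine ih (l := l.rot) G.rot (fun s h => he s ?_) hl
      revert h
      cases e s <;> cases l <;> simp [Direction.rot]
  cases l with
  | L => exact key 0 G he rfl
  | U => exact key 1 G he rfl
  | R => exact key 2 G he rfl
  | D => exact key 3 G he rfl

/-- A sweep yields the sequence `v` of its vertices. All vertices before an edge lie strictly on one
side of it, as that edge starts at one end of the interval occupied so far. -/
theorem exists_vertices (G : ConvexPolygon n γ) {r : ℤ → ℤ → ℤ → Prop} {x y c : ℤ}
    (h : Sweep r x y c) : ∀ N : ℕ, y - x = N → (N : ℤ) < n →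
    ∃ v : ℕ → ℤ, v N = c ∧ (∀ k ≤ N, x ≤ v k ∧ v k ≤ y) ∧ (∀ j k, j < k → k ≤ N → v j ≠ v k) ∧
      (∀ k < N, r k (v k) (v (k + 1))) ∧
      ∀ k < N, (∀ j < k, 0 < orient (γ (v k)) (γ (v (k + 1))) (γ (v j))) ∨
        (∀ j < k, orient (γ (v k)) (γ (v (k + 1))) (γ (v j)) < 0) := by
  have hend : ∀ {x y c : ℤ}, Sweep r x y c → c = x ∨ c = y := by
    intro x y c h
    cases h <;> simp
  -- the common part of the two ways to add a vertex
  have step : ∀ {x y c x' y' c' : ℤ}, Sweep r x y c → r (y - x) c c' → x' ≤ x → y ≤ y' →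
      x' ≤ c' → c' ≤ y' → (c' < x ∨ y < c') →
      (∀ N : ℕ, y - x = N → (N : ℤ) < n →
        ∃ v : ℕ → ℤ, v N = c ∧ (∀ k ≤ N, x ≤ v k ∧ v k ≤ y) ∧
        (∀ j k, j < k → k ≤ N → v j ≠ v k) ∧ (∀ k < N, r k (v k) (v (k + 1))) ∧
        ∀ k < N, (∀ j < k, 0 < orient (γ (v k)) (γ (v (k + 1))) (γ (v j))) ∨
          (∀ j < k, orient (γ (v k)) (γ (v (k + 1))) (γ (v j)) < 0)) →
      ((∀ j, x ≤ j → j ≤ y → j ≠ c → 0 < orient (γ c) (γ c') (γ j)) ∨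
        (∀ j, x ≤ j → j ≤ y → j ≠ c → orient (γ c) (γ c') (γ j) < 0)) →
      ∀ N : ℕ, y - x + 1 = N → (N : ℤ) < n →
        ∃ v : ℕ → ℤ, v N = c' ∧ (∀ k ≤ N, x' ≤ v k ∧ v k ≤ y') ∧
        (∀ j k, j < k → k ≤ N → v j ≠ v k) ∧ (∀ k < N, r k (v k) (v (k + 1))) ∧
        ∀ k < N, (∀ j < k, 0 < orient (γ (v k)) (γ (v (k + 1))) (γ (v j))) ∨
          (∀ j < k, orient (γ (v k)) (γ (v (k + 1))) (γ (v j)) < 0) := by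
    intro x y c x' y' c' h hr hx hy hc1 hc2 hc3 ih hor N hN hn
    have := h.mem_Icc
    obtain ⟨N, rfl⟩ : ∃ M, N = M + 1 := ⟨N - 1, by omega⟩
    push_cast at hN hn
    obtain ⟨v, h1, h2, h3, h4, h5⟩ := ih N (by omega) (by omega)
    have hv : ∀ k ≤ N, Function.update v (N + 1) c' k = v k := fun k hk =>
      Function.update_of_ne (by omega) _ _
    have hv' : Function.update v (N + 1) c' (N + 1) = c' := Function.update_self ..
    refine ⟨Function.update v (N + 1) c', hv', fun k hk => ?_, fun j k hj hk => ?_,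
      fun k hk => ?_, fun k hk => ?_⟩
    · rcases hk.eq_or_lt with rfl | hk
      · rw [hv']; exact ⟨hc1, hc2⟩
      · rw [hv k (by omega)]
        have := h2 k (by omega)
        omega
    · rw [hv j (by omega)]
      rcases hk.eq_or_lt with rfl | hk
      · rw [hv']
        have := h2 j (by omega)
        omega
      · rw [hv k (by omega)]
        exact h3 j k hj (by omega)
    · rw [hv k (by omega)]
      rcases (Nat.lt_succ_iff.1 hk).eq_or_lt with rfl | hk
      · rw [hv', h1, show (k : ℤ) = y - x by omega]
        exact hr
      · rw [hv (k + 1) (by omega)]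
        exact h4 k hk
    · rw [hv k (by omega)]
      rcases (Nat.lt_succ_iff.1 hk).eq_or_lt with rfl | hk
      · rw [hv', h1]
        refine hor.imp (fun h j hj => ?_) (fun h j hj => ?_) <;>
        · rw [hv j (by omega)]
          exact h _ (h2 j (by omega)).1 (h2 j (by omega)).2 (h1 ▸ h3 j k hj le_rfl)
      · rw [hv (k + 1) (by omega)]
        refine (h5 k hk).imp (fun h j hj => ?_) (fun h j hj => ?_) <;>
        · rw [hv j (by omega)]
          exact h j hj
  induction h with
  | single x =>
    intro N hN hn
    obtain rfl : N = 0 := by omega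
    exact ⟨fun _ => x, rfl, fun _ _ => ⟨le_rfl, le_rfl⟩, by omega, by simp, by simp⟩
  | @left x y c h hr ih =>
    intro N hN hn
    have := h.mem_Icc
    refine step h hr (by omega) le_rfl le_rfl (by omega) (by omega) ih ?_ N (by omega) hn
    rcases hend h with rfl | rfl
    · refine .inr fun j h1 h2 h3 => ?_
      rw [orient_swap, neg_lt_zero]
      exact G.ccw _ _ _ (by omega) (by omega) (by omega)
    · refine .inl fun j h1 h2 h3 => ?_
      rw [← orient_rotate]
      exact G.ccw _ _ _ (by omega) (by omega) (by omega)
  | @right x y c h hr ih =>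
    intro N hN hn
    have := h.mem_Icc
    refine step h hr le_rfl (by omega) (by omega) le_rfl (by omega) ih ?_ N (by omega) hn
    rcases hend h with rfl | rfl
    · refine .inr fun j h1 h2 h3 => ?_
      rw [orient_swap, neg_lt_zero, ← orient_rotate]
      exact G.ccw _ _ _ (by omega) (by omega) (by omega)
    · refine .inl fun j h1 h2 h3 => ?_
      rw [orient_rotate]
      exact G.ccw _ _ _ (by omega) (by omega) (by omega)

end ConvexPolygon

/-! ### From point sets to polygons and back -/

theorem mem_convexHull_of_orient_nonpos {b i j k : ℝ × ℝ} (h1 : 0 < orient b i j)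
    (h2 : 0 < orient b j k) (h3 : orient i j k ≤ 0) :
    j ∈ convexHull ℝ ({b, i, k} : Set (ℝ × ℝ)) := by
  have hsum : orient b i k = orient b j k + orient b i j - orient i j k := by
    simp only [orient]; ring
  have hpos : 0 < orient b i k := by linarith
  have hj : j = ∑ t : Fin 3, (![-orient i j k / orient b i k, orient b j k / orient b i k,
      orient b i j / orient b i k] t) • (![b, i, k] t) := by
    rw [Fin.sum_univ_three]
    ext
    · simp
      field_simp
      simp only [orient]; ring
    · simp
      field_simp
      simp only [orient]; ring
  rw [hj]
  refine (convex_convexHull ℝ _).sum_mem (fun t _ => ?_) ?_ (fun t _ => subset_convexHull ℝ _ ?_)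
  · fin_cases t
    · exact div_nonneg (neg_nonneg.2 h3) hpos.le
    · exact div_nonneg h2.le hpos.le
    · exact div_nonneg h1.le hpos.le
  · rw [Fin.sum_univ_three]
    simp
    field_simp
    linarith
  · fin_cases t <;> simp

theorem orient_ne_zero {S : Finset (ℝ × ℝ)} (hgen : InGeneralPosition S) {p q r : ℝ × ℝ}
    (hp : p ∈ S) (hq : q ∈ S) (hr : r ∈ S) (hpq : p ≠ q) (hpr : p ≠ r) (hqr : q ≠ r) :
    orient p q r ≠ 0 := by
  intro h
  refine hgen.2 p hp q hq r hr hpq hpr hqr ?_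
  have h1 : q.2 - p.2 ≠ 0 := sub_ne_zero.2 (hgen.1 p hp q hq hpq).2.symm
  rw [collinear_iff_of_mem (p₀ := p) (by simp)]
  refine ⟨q - p, fun s hs => ?_⟩
  rcases hs with rfl | rfl | rfl
  · exact ⟨0, by simp⟩
  · exact ⟨1, by simp⟩
  · refine ⟨(s.2 - p.2) / (q.2 - p.2), ?_⟩
    simp only [orient] at h
    ext
    · simp
      field_simp
      linarith
    · simp
      field_simp
      ring

/-- The points of `S` in counterclockwise order: the lowest point, then the others sorted by the
direction in which they are seen from it. -/
theorem exists_convexPolygon (m : ℕ) (S : Finset (ℝ × ℝ)) (hcard : S.card = m + 1)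
    (hgen : InGeneralPosition S) (hconv : InConvexPosition S) :
    ∃ γ : ℤ → ℝ × ℝ, ConvexPolygon (m + 1) γ ∧ ∀ i, γ i ∈ S := by
  obtain ⟨b, hbS, hb⟩ := S.exists_min_image (fun p => p.2) (Finset.card_pos.1 (by omega))
  have hb' : ∀ p ∈ S, p ≠ b → 0 < p.2 - b.2 := fun p hp hpb =>
    sub_pos.2 (lt_of_le_of_ne (hb p hp) (hgen.1 b hbS p hp hpb.symm).2)
  -- minus the cotangent of the angle at which `p` is seen from `b`
  let κ : ℝ × ℝ → ℝ := fun p => -((p.1 - b.1) / (p.2 - b.2))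
  have hκ : ∀ p ∈ S, ∀ q ∈ S, p ≠ b → q ≠ b → (κ p < κ q ↔ 0 < orient b p q) := by
    intro p hp q hq hpb hqb
    simp only [κ, neg_lt_neg_iff, orient]
    rw [div_lt_div_iff₀ (hb' q hq hqb) (hb' p hp hpb), ← sub_pos]
    ring_nf
  have hinj : Set.InjOn κ (S.erase b : Finset (ℝ × ℝ)) := by
    intro p hp q hq h
    have hp' := Finset.mem_erase.1 hp
    have hq' := Finset.mem_erase.1 hq
    by_contra hne
    rcases lt_or_gt_of_ne (orient_ne_zero hgen hbS hp'.2 hq'.2 hp'.1.symm hq'.1.symm hne)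
      with h1 | h1
    · refine h.not_gt ((hκ q hq'.2 p hp'.2 hq'.1 hp'.1).2 ?_)
      simp only [orient] at h1 ⊢
      linarith
    · exact h.not_lt ((hκ p hp'.2 q hq'.2 hp'.1 hq'.1).2 h1)
  have hcard' : ((S.erase b).image κ).card = m := by
    rw [Finset.card_image_of_injOn hinj, Finset.card_erase_of_mem hbS, hcard]; rfl
  have hex : ∀ i : Fin m, ∃ p ∈ S.erase b, κ p = ((S.erase b).image κ).orderEmbOfFin hcard' i :=
    fun i => Finset.mem_image.1 (Finset.orderEmbOfFin_mem _ hcard' i)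
  choose g hg1 hg2 using hex
  let δ : ℤ → ℝ × ℝ := fun i => if h : 0 < i ∧ i ≤ m then g ⟨(i - 1).toNat, by omega⟩ else b
  have hδ0 : δ 0 = b := by simp [δ]
  have hδS : ∀ i, δ i ∈ S := by
    intro i
    simp only [δ]
    split_ifs
    · exact Finset.mem_of_mem_erase (hg1 _)
    · exact hbS
  have hδb : ∀ i : ℤ, 0 < i → i ≤ m → δ i ≠ b := by
    intro i h1 h2
    simp only [δ, dif_pos (And.intro h1 h2)]
    exact Finset.ne_of_mem_erase (hg1 _)
  have hδκ : ∀ i j : ℤ, 0 < i → i < j → j ≤ m → κ (δ i) < κ (δ j) := by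
    intro i j h1 h2 h3
    simp only [δ, dif_pos (And.intro h1 (h2.le.trans h3)), dif_pos (And.intro (h1.trans h2) h3),
      hg2]
    refine (OrderEmbedding.lt_iff_lt _).2 ?_
    simp only [Fin.lt_def]
    omega
  have hne : ∀ i j : ℤ, 0 ≤ i → i < j → j ≤ m → δ i ≠ δ j := by
    intro i j h1 h2 h3 h
    rcases h1.eq_or_lt with rfl | h1
    · exact hδb j h2 h3 (h ▸ hδ0)
    · exact (hδκ i j h1 h2 h3).ne (congrArg κ h)
  have hor0 : ∀ i j : ℤ, 0 < i → i < j → j ≤ m → 0 < orient b (δ i) (δ j) := fun i j h1 h2 h3 =>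
    (hκ _ (hδS i) _ (hδS j) (hδb i h1 (by omega)) (hδb j (by omega) h3)).1 (hδκ i j h1 h2 h3)
  have hor : ∀ i j k : ℤ, 0 ≤ i → i < j → j < k → k ≤ m → 0 < orient (δ i) (δ j) (δ k) := by
    intro i j k h1 h2 h3 h4
    rcases h1.eq_or_lt with rfl | h1
    · rw [hδ0]; exact hor0 j k h2 h3 h4
    · by_contra hcon
      have hmem := mem_convexHull_of_orient_nonpos (hor0 i j h1 h2 (by omega))
        (hor0 j k (by omega) h3 h4) (not_lt.1 hcon)
      refine convexIndependent_set_iff_notMem_convexHull_sdiff.1 hconv (δ j) (hδS j)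
        (convexHull_mono ?_ hmem)
      rintro p (rfl | rfl | rfl)
      · exact ⟨hbS, (hδb j (by omega) (by omega)).symm⟩
      · exact ⟨hδS i, hne i j (by omega) h2 (by omega)⟩
      · exact ⟨hδS k, (hne j k (by omega) h3 h4).symm⟩
  have hwin : ∀ i : ℤ, 0 ≤ i % (m + 1) ∧ i % (m + 1) ≤ m := fun i => by
    have h1 := Int.emod_nonneg i (b := m + 1) (by omega)
    have h2 := Int.emod_lt_of_pos i (b := m + 1) (by omega)
    omega
  -- the residue of `j` when `j` lies at most one period after `i`
  have hres : ∀ i j : ℤ, i < j → j < i + (m + 1) →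
      j % (m + 1) = i % (m + 1) + (j - i) ∨ j % (m + 1) = i % (m + 1) + (j - i) - (m + 1) := by
    intro i j h1 h2
    have hi := hwin i
    have h3 : j % (m + 1) = (i % (m + 1) + (j - i)) % (m + 1) := by
      rw [Int.emod_add_emod, add_sub_cancel]
    by_cases h : i % (m + 1) + (j - i) < m + 1
    · left
      rw [h3, Int.emod_eq_of_lt (by omega) h]
    · right
      rw [h3, ← Int.sub_emod_right, Int.emod_eq_of_lt (by omega) (by omega)]
  refine ⟨fun i => δ (i % (m + 1)), ⟨fun i => by simp, fun i j h1 h2 => ?_,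
    fun i j k h1 h2 h3 => ?_⟩, fun i => hδS _⟩
  · refine hgen.1 _ (hδS _) _ (hδS _) ?_
    have := hwin i
    have := hwin j
    rcases hres i j h1 h2 with h | h
    · exact hne _ _ (by omega) (by omega) (by omega)
    · exact (hne _ _ (by omega) (by omega) (by omega)).symm
  · have := hwin i
    have := hwin j
    have := hwin k
    show 0 < orient (δ (i % (m + 1))) (δ (j % (m + 1))) (δ (k % (m + 1)))
    rcases hres i j h1 (by omega) with h | h
    · rcases hres i k (by omega) h3 with h' | h'
      · exact hor _ _ _ (by omega) (by omega) (by omega) (by omega)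
      · rw [orient_rotate (δ (k % (m + 1)))]
        exact hor _ _ _ (by omega) (by omega) (by omega) (by omega)
    · rcases hres i k (by omega) h3 with h' | h'
      · omega
      · rw [← orient_rotate]
        exact hor _ _ _ (by omega) (by omega) (by omega) (by omega)

/-- A drawing is planar if all vertices before an edge lie strictly on one side of it: an affine
function which vanishes on that edge has a constant strict sign on the earlier vertices. -/
theorem isPlanarDrawing_of_orient {m : ℕ} {E : Fin (m + 1) → ℝ × ℝ}
    (h : ∀ k : Fin m, (∀ j, j < k.castSucc → 0 < orient (E k.castSucc) (E k.succ) (E j)) ∨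
      ∀ j, j < k.castSucc → orient (E k.castSucc) (E k.succ) (E j) < 0) :
    IsPlanarDrawing E := by
  have key : ∀ i j : Fin m, i < j → ∀ x, x ∈ segment ℝ (E i.castSucc) (E i.succ) →
      x ∈ segment ℝ (E j.castSucc) (E j.succ) → i.succ = j.castSucc ∧ x = E i.succ := by
    rintro i j hij x ⟨a, b, ha, hb, hab, rfl⟩ ⟨a', b', ha', hb', hab', hx⟩
    have h0 : a * orient (E j.castSucc) (E j.succ) (E i.castSucc) +
        b * orient (E j.castSucc) (E j.succ) (E i.succ) = 0 := by
      have h1 : orient (E j.castSucc) (E j.succ)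
          (a' • E j.castSucc + b' • E j.succ) = 0 := by
        obtain rfl : a' = 1 - b' := by linarith
        simp only [orient, Prod.fst_add, Prod.snd_add, Prod.smul_fst, Prod.smul_snd, smul_eq_mul]
        ring
      rw [hx] at h1
      obtain rfl : a = 1 - b := by linarith
      rw [← h1]
      simp only [orient, Prod.fst_add, Prod.snd_add, Prod.smul_fst, Prod.smul_snd, smul_eq_mul]
      ring
    have hlt : i.castSucc < j.castSucc := by simpa using hij
    have hle : i.succ ≤ j.castSucc := by
      rw [Fin.le_def]; simpa using Nat.succ_le_of_lt hij
    have hs : i.succ = j.castSucc := by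
      by_contra hne
      have hlt' := lt_of_le_of_ne hle hne
      rcases h j with h | h
      · exact ((convex_Ioi (0 : ℝ)) (h _ hlt) (h _ hlt') ha hb hab).ne' h0
      · exact ((convex_Iio (0 : ℝ)) (h _ hlt) (h _ hlt') ha hb hab).ne h0
    refine ⟨hs, ?_⟩
    have hz : orient (E j.castSucc) (E j.succ) (E i.succ) = 0 := by
      rw [hs]; simp only [orient]; ring
    rw [hz, mul_zero, add_zero] at h0
    have ha0 : a = 0 := by
      rcases h j with h | h
      · exact (mul_eq_zero.1 h0).resolve_right (h _ hlt).ne'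
      · exact (mul_eq_zero.1 h0).resolve_right (h _ hlt).ne
    obtain rfl : b = 1 := by linarith
    simp [ha0]
  intro i j hij x hi hj
  rcases lt_or_gt_of_ne hij with hlt | hlt
  · obtain ⟨h1, h2⟩ := key i j hlt x hi hj
    exact ⟨i.succ, .inr rfl, .inl h1, h2⟩
  · obtain ⟨h1, h2⟩ := key j i hlt x hj hi
    exact ⟨j.succ, .inl h1, .inr rfl, h2⟩

theorem exists_notMem_of_card_le_three (T : Finset Direction) (hT : T.card ≤ 3) :
    ∃ l, l ∉ T := by
  by_contra! h
  have : Set.InjOn ![Direction.U, Direction.D, Direction.L, Direction.R]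
      (Finset.univ : Finset (Fin 4)) := by
    intro i _ j _ hij
    fin_cases i <;> fin_cases j <;> first | rfl | cases hij
  have := Finset.card_le_card_of_injOn (t := T) _ (fun i _ => h _) this
  simp at this
  omega

theorem theorem1 (m : ℕ) (P : LabeledPath m) (hP : P.IsThreeDirectional)
    (S : Finset (ℝ × ℝ)) (hcard : S.card = m + 1)
    (hgen : InGeneralPosition S) (hconv : InConvexPosition S) :
    ∃ E : Fin (m + 1) → ℝ × ℝ,
      IsEmbeddingOn S E ∧ IsPlanarDrawing E ∧ IsDirectionConsistent P E := by
  obtain ⟨γ, G, hγS⟩ := exists_convexPolygon m S hcard hgen hconv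
  rcases Nat.eq_zero_or_pos m with rfl | hm
  · exact ⟨fun _ => γ 0, ⟨fun i j _ => by omega, fun _ => hγS 0⟩,
      fun i => i.elim0, fun i => i.elim0⟩
  obtain ⟨T, hT, hPT⟩ := hP
  obtain ⟨l, hl⟩ := exists_notMem_of_card_le_three T hT
  let e : ℤ → Direction := fun s =>
    if h : s.toNat < m then P ⟨s.toNat, h⟩ else P ⟨0, hm⟩
  have he : ∀ s, e s ≠ l := by
    intro s h
    refine hl (h ▸ ?_)
    simp only [e]
    split_ifs <;> exact hPT _
  obtain ⟨x, c, hs⟩ := G.traverse (by omega) he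
  obtain ⟨v, -, hv1, hv2, hv3, hv4⟩ := G.exists_vertices hs m (by ring) (by omega)
  have hinj : ∀ j k, j < k → k ≤ m → γ (v j) ≠ γ (v k) := by
    intro j k hjk hk h
    have h1 := hv1 j (by omega)
    have h2 := hv1 k hk
    rcases lt_or_gt_of_ne (hv2 j k hjk hk) with h3 | h3
    · exact (G.ne _ _ h3 (by omega)).1 (by rw [h])
    · exact (G.ne _ _ h3 (by omega)).1 (by rw [h])
  refine ⟨fun k => γ (v k), ⟨fun j k hjk => ?_, fun k => hγS _⟩,
    isPlanarDrawing_of_orient fun k => ?_, fun k => ?_⟩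
  · by_contra hne
    rcases lt_or_gt_of_ne hne with h | h
    · exact hinj j k h (by omega) hjk
    · exact hinj k j h (by omega) hjk.symm
  · exact (hv4 k k.2).imp (fun h j hj => h j hj) (fun h j hj => h j hj)
  · have := hv3 k k.2
    simpa [StepRel, e] using this
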